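/- **Resource allocation, i.i.d. model.** There are $n$ resources, resource $i$ having capacity $c_i>0$. A finitely supported probability distribution $(p_j)_j$ over requests is given, and $m$ requests arrive one after the other, drawn independently from it. Each request must on arrival be irrevocably either dropped or served by one option $k$; serving request $j$ by option $k$ consumes $a_{ijk}\ge 0$ units of resource $i$ and yields $w_{pjk}\ge 0$ units of type-$p$ profit. The objective is to maximize the minimum among all types of profit, subject to the capacities. Let $W_E$ be the optimal value of the linear program of the expected instance: maximize $\lambda$ subject to $\sum_{j,k} m p_j w_{pjk}x_{jk}\ge\lambda$ for all $p$, $\sum_{j,k} m p_j a_{ijk}x_{jk}\le c_i$ for all $i$, $\sum_k x_{jk}\le 1$ for all $j$, and $x_{jk}\ge 0$. The approximation factor of an online algorithm is its expected profit divided by $W_E$, and $$\gamma=\max\Big(\Big\{\tfrac{a_{ijk}}{c_i}\Big\}_{i,j,k}\cup\Big\{\tfrac{w_{pjk}}{W_E}\Big\}_{p,j,k}\Big).$$ **Theorem.** There are absolute constants $c>0$ and $\varepsilon_0>0$ such that for every $0<\varepsilon\le\varepsilon_0$ and every $n=2^z$ with $z\ge 1$ there is an i.i.d. instance of the resource allocation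 problem with $n$ resources, $W_E>0$ and $$\gamma=\frac{\varepsilon^2}{\log n}$$ on which every online algorithm, possibly randomized and with complete knowledge of the distribution and of $m$, has approximation factor at most $1-c\,\varepsilon$; that is, no algorithm gets a $1-o(\varepsilon)$ approximation. Moreover, the instance can be taken of the following form. There is one type of profit, each request has one option, and all capacities equal the same number $B$. The resources are indexed by the binary strings $b\in\{0,1\}^z$; for $1\le i\le z$ let $v_i,w_i\in\{0,1\}^{n}$ be the complementary vectors $v_i(b)=b_i$ and $w_i(b)=1-b_i$. For some $\alpha\in(0,1)$, each request, if served, consumes the zero vector, $\alpha v_i$ or $w_i$ for some $i$, and for every $i$ both $\alpha v_i$ and $w_i$ occur. -/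

import Mathlib

open scoped BigOperators

namespace ResourceAllocation

noncomputable section

/-- An i.i.d. instance of the resource allocation problem. `A` is the set of resources, `P` the set
of profit types, `J` the set of requests in the support of the distribution and `K` the set of
options. Serving request `j` by option `k` consumes `a i j k` units of resource `i` and yields
`w p j k` units of type-`p` profit; `m` requests arrive, each drawn independently from the
distribution `prob` on `J`. -/
structure Instance (A P J K : Type) [Fintype J] where
  m : ℕ
  cap : A → ℝ
  cap_pos : ∀ i, 0 < cap i
  a : A → J → K → ℝ
  a_nonneg : ∀ i j k, 0 ≤ a i j k
  w : P → J → K → ℝ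
  w_nonneg : ∀ p j k, 0 ≤ w p j k
  prob : J → ℝ
  prob_pos : ∀ j, 0 < prob j
  prob_sum : ∑ j, prob j = 1

namespace Instance

variable {A P J K : Type} [Fintype J]

/-- Feasibility of a fractional solution `x` for the linear program of the expected instance. -/
def ExpectedFeasible [Fintype K] (I : Instance A P J K) (x : J → K → ℝ) : Prop :=
  (∀ i, ∑ j, ∑ k, (I.m : ℝ) * I.prob j * I.a i j k * x j k ≤ I.cap i) ∧
  (∀ j, ∑ k, x j k ≤ 1) ∧
  (∀ j k, 0 ≤ x j k)

/-- The fractional optimum `W_E` of the expected instance: the largest `l` such that some feasible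
fractional solution gives at least `l` units of every type of profit. -/
def expectedOpt [Fintype K] (I : Instance A P J K) : ℝ :=
  sSup {l : ℝ | ∃ x : J → K → ℝ, I.ExpectedFeasible x ∧
    ∀ p, l ≤ ∑ j, ∑ k, (I.m : ℝ) * I.prob j * I.w p j k * x j k}

/-- The parameter `γ`: the maximum of all ratios `a i j k / cap i` and `w p j k / W_E`. -/
def gamma [Fintype K] (I : Instance A P J K) : ℝ :=
  sSup ({y : ℝ | ∃ i j k, y = I.a i j k / I.cap i} ∪
    {y : ℝ | ∃ p j k, y = I.w p j k / I.expectedOpt})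

/-- The amount of resource `i` consumed when the requests `r` are served by the options `o`, where
`none` means that the request is dropped. -/
def consumption (I : Instance A P J K) (r : Fin I.m → J) (o : Fin I.m → Option K) (i : A) : ℝ :=
  ∑ t, (o t).elim 0 (I.a i (r t))

/-- The objective value: the minimum among all types of profit. -/
def profit (I : Instance A P J K) (r : Fin I.m → J) (o : Fin I.m → Option K) : ℝ :=
  ⨅ p, ∑ t, (o t).elim 0 (I.w p (r t))

end Instance

/-- A randomized online algorithm for the instance `I`, with random seed drawn from `(Ω, μ)`
independently of the requests. `choice ω r t` is the irrevocable decision on the `t`-th request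
of the sequence `r` when the seed is `ω`. As the algorithm is chosen for the given `I`, it may
depend on the distribution of the requests, on `m` and on all other data in an arbitrary way. -/
structure OnlineAlgorithm {A P J K : Type} [Fintype J] (I : Instance A P J K)
    (Ω : Type*) [MeasurableSpace Ω] (μ : MeasureTheory.Measure Ω) where
  choice : Ω → (Fin I.m → J) → Fin I.m → Option K
  measurable_choice : ∀ r t o, MeasurableSet {ω | choice ω r t = o}
  /-- A decision depends only on the requests that have arrived so far. -/
  online : ∀ ω r r' t, (∀ s, s ≤ t → r s = r' s) → choice ω r t = choice ω r' t
  /-- The capacities are never exceeded. -/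
  feasible : ∀ r, ∀ᵐ ω ∂μ, ∀ i, I.consumption r (choice ω r) i ≤ I.cap i

namespace OnlineAlgorithm

variable {A P J K : Type} [Fintype J] {I : Instance A P J K}
  {Ω : Type*} [MeasurableSpace Ω] {μ : MeasureTheory.Measure Ω}

/-- The expected profit, over `m` independent requests and the random seed. -/
def expectedProfit (alg : OnlineAlgorithm I Ω μ) : ℝ :=
  ∑ r : Fin I.m → J, (∏ t, I.prob (r t)) * ∫ ω, I.profit r (alg.choice ω r) ∂μ

/-- The approximation factor: the ratio of the expected profit to `W_E`. -/
def approxFactor [Fintype K] (alg : OnlineAlgorithm I Ω μ) : ℝ :=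
  alg.expectedProfit / I.expectedOpt

end OnlineAlgorithm

/-- The binary vector `v_i`, indexed by all binary strings of length `z`: the `i`-th column of the
`2^z × z` matrix whose rows are these strings. -/
def vecV {z : ℕ} (i : Fin z) (b : Fin z → Bool) : ℝ := if b i then 1 else 0

/-- The binary vector `w_i`, the complement of `v_i`. -/
def vecW {z : ℕ} (i : Fin z) (b : Fin z → Bool) : ℝ := if b i then 0 else 1

/-- All capacities are equal to `B`, and each request, if served, consumes nothing, or `α • v_i`,
or `w_i` for some `i`; for each `i`, both vectors occur among the requests. -/
def IsComplementary {z : ℕ} {J : Type} [Fintype J] (α B : ℝ)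
    (I : Instance (Fin z → Bool) Unit J Unit) : Prop :=
  (∀ b, I.cap b = B) ∧
  (∀ j, (∀ b, I.a b j () = 0) ∨
    ∃ i, (∀ b, I.a b j () = α * vecV i b) ∨ (∀ b, I.a b j () = vecW i b)) ∧
  (∀ i, (∃ j, ∀ b, I.a b j () = α * vecV i b) ∧ (∃ j, ∀ b, I.a b j () = vecW i b))

end

end ResourceAllocation

/-! The profits are balanced so that each of the `2 * z` request types has expected total profit `B
/ z`. Each resource `b` selects one type from every pair, so serving everything uses each capacity
exactly in expectation, and `W_E = 2 * B`. In an actual run, the resource selecting the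
better-served type of each pair forces the sum of these maxima to be at most `B`. The profit is
therefore at most `B + ∑ min (X i) (Y i)`, with `X i`, `Y i` the arrived totals of the pair
(`served_profit_le`). This holds for every request sequence, so even with hindsight. Since `min X Y
= (X + Y - |X - Y|) / 2`, each pair loses `E|X - Y| / 2`, which is of order `√(B / z)` by a
fourth-moment bound (`iidMean_abs_ge`). With `B / z = log 2 / ε ^ 2` the relative loss is of order
`ε`. -/

namespace ResourceAllocation

open Finset

/-! ### Moments of sums of independent draws -/

section Moments

variable {J : Type*} [Fintype J]

/-- The expectation of `F` over `m` independent draws from the weights `p`. -/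
noncomputable def iidMean (p : J → ℝ) (m : ℕ) (F : (Fin m → J) → ℝ) : ℝ :=
  ∑ r : Fin m → J, (∏ t, p (r t)) * F r

/-- Conditioning on the first draw; the moment formulas follow from it by induction on `m`. -/
lemma iidMean_succ (p : J → ℝ) (m : ℕ) (F : (Fin (m + 1) → J) → ℝ) :
    iidMean p (m + 1) F = ∑ j, p j * iidMean p m (fun r => F (Fin.cons j r)) := by
  unfold iidMean
  rw [← (Fin.consEquiv (fun _ : Fin (m + 1) => J)).sum_comp, Fintype.sum_prod_type]
  refine Finset.sum_congr rfl fun j _ => ?_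
  rw [Finset.mul_sum]
  refine Finset.sum_congr rfl fun r _ => ?_
  simp [Fin.consEquiv, Fin.prod_univ_succ, mul_assoc]

lemma iidMean_add (p : J → ℝ) (m : ℕ) (F G : (Fin m → J) → ℝ) :
    iidMean p m (fun r => F r + G r) = iidMean p m F + iidMean p m G := by
  simp [iidMean, mul_add, Finset.sum_add_distrib]

lemma iidMean_const_mul (p : J → ℝ) (m : ℕ) (c : ℝ) (F : (Fin m → J) → ℝ) :
    iidMean p m (fun r => c * F r) = c * iidMean p m F := by
  simp only [iidMean, Finset.mul_sum]
  exact Finset.sum_congr rfl fun r _ => by ring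

lemma iidMean_sum {ι : Type*} (s : Finset ι) (p : J → ℝ) (m : ℕ) (F : ι → (Fin m → J) → ℝ) :
    iidMean p m (fun r => ∑ i ∈ s, F i r) = ∑ i ∈ s, iidMean p m (F i) := by
  simp only [iidMean, Finset.mul_sum]
  exact Finset.sum_comm

lemma iidMean_mono {p : J → ℝ} (hp : ∀ j, 0 ≤ p j) {m : ℕ} {F G : (Fin m → J) → ℝ}
    (h : ∀ r, F r ≤ G r) : iidMean p m F ≤ iidMean p m G :=
  Finset.sum_le_sum fun r _ =>
    mul_le_mul_of_nonneg_left (h r) (Finset.prod_nonneg fun t _ => hp (r t))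

lemma iidMean_const {p : J → ℝ} (hp : ∑ j, p j = 1) (m : ℕ) (c : ℝ) :
    iidMean p m (fun _ => c) = c := by
  induction m with
  | zero => simp [iidMean]
  | succ m ih => simp only [iidMean_succ, ih, ← Finset.sum_mul, hp, one_mul]

lemma iidMean_linear {p : J → ℝ} (hp : ∑ j, p j = 1) (m : ℕ) (f : J → ℝ) :
    iidMean p m (fun r => ∑ t, f (r t)) = m * ∑ j, p j * f j := by
  induction m with
  | zero => simp [iidMean]
  | succ m ih =>
    simp only [iidMean_succ, Fin.sum_univ_succ, Fin.cons_zero, Fin.cons_succ, iidMean_add,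
      iidMean_const hp, ih, mul_add, Finset.sum_add_distrib, ← Finset.sum_mul, hp]
    push_cast
    ring

lemma iidMean_sq {p : J → ℝ} (hp : ∑ j, p j = 1) {f : J → ℝ} (hf : ∑ j, p j * f j = 0) (m : ℕ) :
    iidMean p m (fun r => (∑ t, f (r t)) ^ 2) = m * ∑ j, p j * f j ^ 2 := by
  induction m with
  | zero => simp [iidMean]
  | succ m ih =>
    have h1 : ∀ j, iidMean p m (fun r => (∑ t, f ((Fin.cons j r : Fin (m + 1) → J) t)) ^ 2) =
        f j ^ 2 + m * ∑ j, p j * f j ^ 2 := by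
      intro j
      have h : (fun r : Fin m → J => (∑ t, f ((Fin.cons j r : Fin (m + 1) → J) t)) ^ 2) =
          fun r => f j ^ 2 + ((2 * f j) * (∑ t, f (r t)) + (∑ t, f (r t)) ^ 2) := by
        funext r
        rw [Fin.sum_univ_succ]
        simp only [Fin.cons_zero, Fin.cons_succ]
        ring
      rw [h, iidMean_add, iidMean_add, iidMean_const hp, iidMean_const_mul, iidMean_linear hp, hf,
        ih]
      ring
    simp only [iidMean_succ, h1, mul_add, Finset.sum_add_distrib, ← Finset.sum_mul, hp]
    push_cast
    ring

lemma iidMean_fourth {p : J → ℝ} (hp : ∑ j, p j = 1) {f : J → ℝ} (hf : ∑ j, p j * f j = 0)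
    (m : ℕ) :
    iidMean p m (fun r => (∑ t, f (r t)) ^ 4) =
      m * ∑ j, p j * f j ^ 4 + 3 * (m * (m - 1)) * (∑ j, p j * f j ^ 2) ^ 2 := by
  induction m with
  | zero => simp [iidMean]
  | succ m ih =>
    set s := ∑ j, p j * f j ^ 2 with hs
    set q := ∑ j, p j * f j ^ 4 with hq
    -- The third moment need not be computed: its coefficient is the mean of `f`, which is zero.
    set C := iidMean p m (fun r => (∑ t, f (r t)) ^ 3) with hC
    have h1 : ∀ j, p j * iidMean p m
        (fun r => (∑ t, f ((Fin.cons j r : Fin (m + 1) → J) t)) ^ 4) =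
        p j * f j ^ 4 + (6 * (m * s)) * (p j * f j ^ 2) + (4 * C) * (p j * f j) +
          (m * q + 3 * (m * (m - 1)) * s ^ 2) * p j := by
      intro j
      have h : (fun r : Fin m → J => (∑ t, f ((Fin.cons j r : Fin (m + 1) → J) t)) ^ 4) =
          fun r => f j ^ 4 + ((4 * f j ^ 3) * (∑ t, f (r t)) + ((6 * f j ^ 2) *
            (∑ t, f (r t)) ^ 2 + ((4 * f j) * (∑ t, f (r t)) ^ 3 + (∑ t, f (r t)) ^ 4))) := by
        funext r
        rw [Fin.sum_univ_succ]
        simp only [Fin.cons_zero, Fin.cons_succ]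
        ring
      rw [h]
      simp only [iidMean_add, iidMean_const hp, iidMean_const_mul]
      rw [iidMean_linear hp, hf, iidMean_sq hp hf, ih, ← hC, ← hs]
      ring
    rw [iidMean_succ, Finset.sum_congr rfl fun j _ => h1 j]
    simp only [Finset.sum_add_distrib, ← Finset.mul_sum, hp, hf, ← hs, ← hq]
    push_cast
    ring

/-- A lower bound for the absolute first moment of a centred sum by its standard deviation. -/
lemma iidMean_abs_ge {p : J → ℝ} (hp0 : ∀ j, 0 ≤ p j) (hp : ∑ j, p j = 1) {f : J → ℝ}
    (hf : ∑ j, p j * f j = 0) (hf1 : ∀ j, |f j| ≤ 1) {m : ℕ} {σ : ℝ} (hσ : 1 ≤ σ)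
    (hvar : m * ∑ j, p j * f j ^ 2 = σ ^ 2) :
    3 / 8 * σ ≤ iidMean p m (fun r => |∑ t, f (r t)|) := by
  have hσ0 : 0 < σ := by linarith
  -- With `|s| = 2 * σ * u` this reads `u ^ 2 - u ^ 4 / 4 ≤ u`. As the fourth moment is at most `4 *
  -- σ ^ 4`, taking means gives `σ / 2 - σ / 8`.
  have hpt : ∀ s : ℝ, 1 / (2 * σ) * s ^ 2 + (-(1 / (32 * σ ^ 3))) * s ^ 4 ≤ |s| := by
    intro s
    obtain ⟨u, hu⟩ : ∃ u, |s| = 2 * σ * u := ⟨|s| / (2 * σ), by field_simp⟩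
    have hu0 : 0 ≤ u := by
      have := abs_nonneg s
      rw [hu] at this
      exact nonneg_of_mul_nonneg_right this (by positivity)
    have h2 : s ^ 2 = 4 * σ ^ 2 * u ^ 2 := by rw [← sq_abs, hu]; ring
    have h4 : s ^ 4 = 16 * σ ^ 4 * u ^ 4 := by
      rw [show s ^ 4 = (s ^ 2) ^ 2 by ring, h2]; ring
    rw [hu, h2, h4]
    have e : 1 / (2 * σ) * (4 * σ ^ 2 * u ^ 2) + (-(1 / (32 * σ ^ 3))) * (16 * σ ^ 4 * u ^ 4) =
        2 * σ * (u ^ 2 - u ^ 4 / 4) := by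
      field_simp
      ring
    rw [e]
    refine mul_le_mul_of_nonneg_left ?_ (by positivity)
    have h3 : 0 ≤ 1 - u + u ^ 3 / 4 := by
      nlinarith [mul_nonneg hu0 (sq_nonneg (u - 3 / 2)), sq_nonneg (u - 3 / 2),
        sq_nonneg (u - 1)]
    nlinarith [mul_nonneg hu0 h3]
  have hmean := iidMean_mono hp0 (m := m) fun r => hpt (∑ t, f (r t))
  rw [iidMean_add, iidMean_const_mul, iidMean_const_mul, iidMean_sq hp hf, iidMean_fourth hp hf,
    hvar] at hmean
  have h42 : (m : ℝ) * ∑ j, p j * f j ^ 4 ≤ σ ^ 2 := by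
    rw [← hvar]
    refine mul_le_mul_of_nonneg_left (Finset.sum_le_sum fun j _ => ?_) (Nat.cast_nonneg m)
    refine mul_le_mul_of_nonneg_left ?_ (hp0 j)
    have : f j ^ 2 ≤ 1 := (sq_le_one_iff_abs_le_one _).2 (hf1 j)
    nlinarith [sq_nonneg (f j)]
  have hmm : 3 * ((m : ℝ) * (m - 1)) * (∑ j, p j * f j ^ 2) ^ 2 ≤ 3 * σ ^ 4 := by
    have : 3 * σ ^ 4 = 3 * (m * ∑ j, p j * f j ^ 2) ^ 2 := by rw [hvar]; ring
    rw [this]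
    nlinarith [mul_nonneg (Nat.cast_nonneg (α := ℝ) m) (sq_nonneg (∑ j, p j * f j ^ 2))]
  -- Here `1 ≤ σ` absorbs the diagonal part of the fourth moment.
  have hσ2 : σ ^ 2 ≤ σ ^ 4 := pow_le_pow_right₀ hσ (by norm_num)
  refine le_trans ?_ hmean
  have h5 : 1 / (32 * σ ^ 3) * ((m : ℝ) * ∑ j, p j * f j ^ 4 +
      3 * ((m : ℝ) * (m - 1)) * (∑ j, p j * f j ^ 2) ^ 2) ≤ 1 / (32 * σ ^ 3) * (4 * σ ^ 4) :=
    mul_le_mul_of_nonneg_left (by linarith) (by positivity)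
  have h6 : 1 / (32 * σ ^ 3) * (4 * σ ^ 4) = σ / 8 := by field_simp; ring
  have h7 : 1 / (2 * σ) * σ ^ 2 = σ / 2 := by field_simp
  linarith

end Moments

/-! ### Complementary pairs and the pathwise profit bound -/

section HardInstance

variable {z : ℕ}

/-- The amount consumed by the request of type `v_i` (left) or `w_i` (right). -/
noncomputable def pairUse (α : ℝ) (b : Fin z → Bool) : Fin z ⊕ Fin z → ℝ :=
  Sum.elim (fun i => α * vecV i b) (fun i => vecW i b)

/-- The profit of a request: `α` for type `v_i` and `1` for type `w_i`. -/
noncomputable def pairProfit (α : ℝ) : Fin z ⊕ Fin z → ℝ := Sum.elim (fun _ => α) (fun _ => 1)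

/-- The distribution that makes the expected total profit of each type equal to `B / z`. -/
noncomputable def pairProb (z m : ℕ) (B : ℝ) : Fin z ⊕ Fin z → ℝ :=
  Sum.elim (fun _ => (m - B) / (z * m)) (fun _ => B / (z * m))

/-- The profit of a request if it is of type `v_i`, and zero otherwise. -/
noncomputable def leftPart (α : ℝ) (i : Fin z) (j : Fin z ⊕ Fin z) : ℝ :=
  if j = Sum.inl i then α else 0

/-- The profit of a request if it is of type `w_i`, and zero otherwise. -/
noncomputable def rightPart (i : Fin z) (j : Fin z ⊕ Fin z) : ℝ :=
  if j = Sum.inr i then 1 else 0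

lemma pairProfit_eq_sum (α : ℝ) (j : Fin z ⊕ Fin z) :
    pairProfit α j = ∑ i, (leftPart α i j + rightPart i j) := by
  rcases j with j | j <;> simp [pairProfit, leftPart, rightPart]

lemma pairUse_eq_sum (α : ℝ) (b : Fin z → Bool) (j : Fin z ⊕ Fin z) :
    pairUse α b j = ∑ i, if b i then leftPart α i j else rightPart i j := by
  rcases j with j | j
  · have : ∀ i, (if b i then leftPart α i (Sum.inl j) else rightPart i (Sum.inl j)) =
        if j = i then (if b j then α else 0) else 0 := by
      intro i
      by_cases h : j = i
      · subst h; simp [leftPart, rightPart]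
      · simp [leftPart, rightPart, h]
    simp [this, pairUse, vecV]
  · have : ∀ i, (if b i then leftPart α i (Sum.inr j) else rightPart i (Sum.inr j)) =
        if j = i then (if b j then 0 else 1) else 0 := by
      intro i
      by_cases h : j = i
      · subst h; simp [leftPart, rightPart]
      · simp [leftPart, rightPart, h]
    simp [this, pairUse, vecW]

lemma leftPart_nonneg {α : ℝ} (hα : 0 ≤ α) (i : Fin z) (j : Fin z ⊕ Fin z) :
    0 ≤ leftPart α i j := by
  unfold leftPart; split_ifs <;> simp [hα]

lemma rightPart_nonneg (i : Fin z) (j : Fin z ⊕ Fin z) : 0 ≤ rightPart i j := by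
  unfold rightPart; split_ifs <;> simp

lemma abs_leftPart_sub_rightPart_le {α : ℝ} (hα : 0 ≤ α) (hα1 : α ≤ 1) (i : Fin z)
    (j : Fin z ⊕ Fin z) : |leftPart α i j - rightPart i j| ≤ 1 := by
  rcases j with k | k
  · by_cases h : k = i <;> simp [leftPart, rightPart, h, abs_of_nonneg hα, hα1]
  · by_cases h : k = i <;> simp [leftPart, rightPart, h]

lemma pairProb_sum {m : ℕ} (hz : z ≠ 0) (hm : m ≠ 0) (B : ℝ) : ∑ j, pairProb z m B j = 1 := by
  have hz' : (z : ℝ) ≠ 0 := Nat.cast_ne_zero.2 hz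
  have hm' : (m : ℝ) ≠ 0 := Nat.cast_ne_zero.2 hm
  simp [pairProb, Fintype.sum_sum_type]
  field_simp
  ring

/-- Only the two types of pair `i` contribute, since `g 0 0 = 0`. A general `g` covers sums,
differences, squares and resource use at once. -/
lemma sum_pairProb_mul (m : ℕ) (B α : ℝ) (i : Fin z) (g : ℝ → ℝ → ℝ) (g0 : g 0 0 = 0) :
    ∑ j, pairProb z m B j * g (leftPart α i j) (rightPart i j) =
      (m - B) / (z * m) * g α 0 + B / (z * m) * g 0 1 := by
  rw [Fintype.sum_sum_type]
  congr 1
  · rw [Finset.sum_eq_single i]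
    · simp [pairProb, leftPart, rightPart]
    · intro j _ hj
      simp [leftPart, rightPart, hj, g0]
    · simp
  · rw [Finset.sum_eq_single i]
    · simp [pairProb, leftPart, rightPart]
    · intro j _ hj
      simp [leftPart, rightPart, hj, g0]
    · simp

lemma pairUse_nonneg {α : ℝ} (hα : 0 ≤ α) (b : Fin z → Bool) (j : Fin z ⊕ Fin z) :
    0 ≤ pairUse α b j := by
  rw [pairUse_eq_sum]
  refine Finset.sum_nonneg fun i _ => ?_
  split_ifs
  exacts [leftPart_nonneg hα i j, rightPart_nonneg i j]

lemma pairUse_le_one {α : ℝ} (hα : α ≤ 1) (b : Fin z → Bool) (j : Fin z ⊕ Fin z) :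
    pairUse α b j ≤ 1 := by
  rcases j with j | j
  · simp only [pairUse, Sum.elim_inl, vecV]; split_ifs <;> simp [hα]
  · simp only [pairUse, Sum.elim_inr, vecW]; split_ifs <;> simp

lemma pairProfit_nonneg {α : ℝ} (hα : 0 ≤ α) (j : Fin z ⊕ Fin z) : 0 ≤ pairProfit α j := by
  rcases j with j | j <;> simp [pairProfit, hα]

lemma pairProfit_le_one {α : ℝ} (hα : α ≤ 1) (j : Fin z ⊕ Fin z) : pairProfit α j ≤ 1 := by
  rcases j with j | j <;> simp [pairProfit, hα]

/-- If the requests served (those with `s t = 1`) respect all capacities `B`, then their profit is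
at most `B` plus the sum over `i` of the smaller of the two total profits of the requests of types
`v_i` and `w_i`. -/
lemma served_profit_le {m : ℕ} {α B : ℝ} (hα : 0 ≤ α) (q : Fin m → Fin z ⊕ Fin z)
    (s : Fin m → ℝ) (s1 : ∀ t, s t ≤ 1)
    (hB : ∀ b, ∑ t, s t * pairUse α b (q t) ≤ B) :
    ∑ t, s t * pairProfit α (q t) ≤ B + ∑ i, (1 / 2 * (∑ t, (leftPart α i (q t) +
      rightPart i (q t))) + (-(1 / 2)) * |∑ t, (leftPart α i (q t) - rightPart i (q t))|) := by
  set x : Fin z → ℝ := fun i => ∑ t, s t * leftPart α i (q t) with hx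
  set y : Fin z → ℝ := fun i => ∑ t, s t * rightPart i (q t) with hy
  have hprofit : ∑ t, s t * pairProfit α (q t) = ∑ i, (x i + y i) := by
    simp only [hx, hy, ← Finset.sum_add_distrib, pairProfit_eq_sum, Finset.mul_sum, mul_add]
    rw [Finset.sum_comm]
  have huse : ∀ b : Fin z → Bool, ∑ t, s t * pairUse α b (q t) =
      ∑ i, if b i then x i else y i := by
    intro b
    simp only [pairUse_eq_sum, Finset.mul_sum]
    rw [Finset.sum_comm]
    refine Finset.sum_congr rfl fun i _ => ?_
    cases h : b i <;> simp [hx, hy]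
  -- All binary strings index resources, so one of them selects the larger served total in every
  -- pair.
  have hmax : ∑ i, max (x i) (y i) ≤ B := by
    refine le_of_eq_of_le ?_ ((huse fun i => decide (y i ≤ x i)) ▸ hB _)
    refine Finset.sum_congr rfl fun i _ => ?_
    by_cases h : y i ≤ x i
    · simp [h]
    · simp [h, le_of_lt (not_le.1 h)]
  rw [hprofit]
  have hmin : ∀ i, x i + y i ≤ max (x i) (y i) + (1 / 2 * (∑ t, (leftPart α i (q t) +
      rightPart i (q t))) + (-(1 / 2)) * |∑ t, (leftPart α i (q t) - rightPart i (q t))|) := by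
    intro i
    have hxX : x i ≤ ∑ t, leftPart α i (q t) := Finset.sum_le_sum fun t _ =>
      mul_le_of_le_one_left (leftPart_nonneg hα _ _) (s1 t)
    have hyY : y i ≤ ∑ t, rightPart i (q t) := Finset.sum_le_sum fun t _ =>
      mul_le_of_le_one_left (rightPart_nonneg _ _) (s1 t)
    rw [Finset.sum_add_distrib, Finset.sum_sub_distrib]
    have h1 := le_max_left (x i) (y i)
    have h2 := le_max_right (x i) (y i)
    rcases abs_cases (∑ t, leftPart α i (q t) - ∑ t, rightPart i (q t)) with h | h <;> linarith
  refine (Finset.sum_le_sum fun i _ => hmin i).trans ?_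
  rw [Finset.sum_add_distrib]
  exact add_le_add_left hmax _

/-! ### The instance, its `W_E` and its `γ` -/

/-- The instance with `m` requests in which the pairs of complementary requests `α • v_i` and `w_i`
balance in expectation. -/
noncomputable def pairInstance (z m : ℕ) (B α : ℝ) (hz : z ≠ 0) (hB : 0 < B) (hBm : B < m)
    (hα : 0 ≤ α) : Instance (Fin z → Bool) Unit (Fin (z + z)) Unit where
  m := m
  cap _ := B
  cap_pos _ := hB
  a b j _ := pairUse α b (finSumFinEquiv.symm j)
  a_nonneg b j _ := pairUse_nonneg hα b _
  w _ j _ := pairProfit α (finSumFinEquiv.symm j)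
  w_nonneg _ j _ := pairProfit_nonneg hα _
  prob j := pairProb z m B (finSumFinEquiv.symm j)
  prob_pos j := by
    have hz' : (0 : ℝ) < z := Nat.cast_pos.2 (Nat.pos_of_ne_zero hz)
    have hm' : (0 : ℝ) < m := hB.trans hBm
    have h : (0 : ℝ) < m - B := sub_pos.2 hBm
    rcases finSumFinEquiv.symm j with i | i <;> simp only [pairProb, Sum.elim_inl, Sum.elim_inr] <;>
      positivity
  prob_sum := by
    have hm : m ≠ 0 := by rintro rfl; simp at hBm; linarith
    rw [finSumFinEquiv.symm.sum_comp (pairProb z m B)]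
    exact pairProb_sum hz hm B

variable {m : ℕ} {B α : ℝ}

lemma isComplementary_pairInstance (hz : z ≠ 0) (hB : 0 < B) (hBm : B < m) (hα : 0 ≤ α) :
    IsComplementary α B (pairInstance z m B α hz hB hBm hα) := by
  refine ⟨fun _ => rfl, fun j => Or.inr ?_, fun i => ⟨⟨finSumFinEquiv (Sum.inl i), fun b => ?_⟩,
    ⟨finSumFinEquiv (Sum.inr i), fun b => ?_⟩⟩⟩
  · rcases h : finSumFinEquiv.symm j with i | i
    · exact ⟨i, Or.inl fun b => by simp [pairInstance, h, pairUse]⟩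
    · exact ⟨i, Or.inr fun b => by simp [pairInstance, h, pairUse]⟩
  · simp only [pairInstance, Equiv.symm_apply_apply]; rfl
  · simp only [pairInstance, Equiv.symm_apply_apply]; rfl

/-- Factoring `α` out of `g α 0` lets the balance condition `(m - B) * α = B` give both types the
same weight `B / z`. -/
lemma mul_sum_pairProb_mul (hz : z ≠ 0) (hm : (m : ℝ) ≠ 0) (hαB : (m - B) * α = B) (i : Fin z)
    (g : ℝ → ℝ → ℝ) (g0 : g 0 0 = 0) (β : ℝ) (hβ : g α 0 = α * β) :
    (m : ℝ) * ∑ j, pairProb z m B j * g (leftPart α i j) (rightPart i j) =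
      B / z * (β + g 0 1) := by
  have hz' : (z : ℝ) ≠ 0 := Nat.cast_ne_zero.2 hz
  rw [sum_pairProb_mul m B α i g g0, hβ]
  field_simp
  rw [hαB]
  ring

lemma sum_use_pairInstance (hz : z ≠ 0) (hB : 0 < B) (hBm : B < m)
    (hαB : (m - B) * α = B) (b : Fin z → Bool) :
    ∑ j, (m : ℝ) * pairProb z m B j * pairUse α b j = B := by
  have hz' : (z : ℝ) ≠ 0 := Nat.cast_ne_zero.2 hz
  have hm : (m : ℝ) ≠ 0 := (hB.trans hBm).ne'
  have h : ∀ i, (m : ℝ) * ∑ j, pairProb z m B j *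
      (if b i then leftPart α i j else rightPart i j) = B / z := by
    intro i
    rw [mul_sum_pairProb_mul hz hm hαB i (fun x y => if b i then x else y) (by simp)
      (if b i then 1 else 0) (by simp)]
    split_ifs <;> simp
  simp only [mul_assoc, ← Finset.mul_sum, pairUse_eq_sum]
  simp only [Finset.mul_sum (s := (Finset.univ : Finset (Fin z)))]
  rw [Finset.sum_comm, Finset.mul_sum, Finset.sum_congr rfl fun i _ => h i]
  simp
  field_simp

lemma sum_profit_pairInstance (hz : z ≠ 0) (hB : 0 < B) (hBm : B < m)
    (hαB : (m - B) * α = B) :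
    ∑ j, (m : ℝ) * pairProb z m B j * pairProfit α (z := z) j = 2 * B := by
  have hz' : (z : ℝ) ≠ 0 := Nat.cast_ne_zero.2 hz
  have hm : (m : ℝ) ≠ 0 := (hB.trans hBm).ne'
  have h : ∀ i : Fin z, (m : ℝ) * ∑ j, pairProb z m B j * (leftPart α i j + rightPart i j) =
      B / z * 2 := by
    intro i
    rw [mul_sum_pairProb_mul hz hm hαB i (fun x y => x + y) (by simp) 1 (by simp)]
    norm_num
  simp only [mul_assoc, ← Finset.mul_sum, pairProfit_eq_sum]
  simp only [Finset.mul_sum (s := (Finset.univ : Finset (Fin z)))]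
  rw [Finset.sum_comm, Finset.mul_sum, Finset.sum_congr rfl fun i _ => h i]
  simp
  field_simp

/-- The all-ones solution is feasible, with every capacity tight, and no solution exceeds the total
expected profit. -/
lemma expectedOpt_pairInstance (hz : z ≠ 0) (hB : 0 < B) (hBm : B < m) (hα : 0 ≤ α)
    (hαB : (m - B) * α = B) :
    (pairInstance z m B α hz hB hBm hα).expectedOpt = 2 * B := by
  have hprofit : ∑ j : Fin (z + z), (m : ℝ) * pairProb z m B (finSumFinEquiv.symm j) *
      pairProfit α (finSumFinEquiv.symm j) = 2 * B := by
    rw [finSumFinEquiv.symm.sum_comp fun j => (m : ℝ) * pairProb z m B j * pairProfit α j]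
    exact sum_profit_pairInstance hz hB hBm hαB
  refine IsGreatest.csSup_eq ⟨⟨fun _ _ => 1, ⟨fun b => ?_, fun j => by simp, fun _ _ => zero_le_one⟩,
    fun _ => ?_⟩, ?_⟩
  · refine le_of_eq ?_
    simp only [Finset.univ_unique, Finset.sum_singleton, mul_one]
    refine Eq.trans ?_ (sum_use_pairInstance hz hB hBm hαB b)
    exact finSumFinEquiv.symm.sum_comp fun j => (m : ℝ) * pairProb z m B j * pairUse α b j
  · simp only [Finset.univ_unique, Finset.sum_singleton, mul_one]
    exact hprofit.ge
  · rintro l ⟨x, ⟨-, hx1, -⟩, hl⟩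
    refine (hl ()).trans (hprofit ▸ Finset.sum_le_sum fun j _ => ?_)
    have hx := hx1 j
    simp only [Finset.univ_unique, Finset.sum_singleton] at hx ⊢
    exact mul_le_of_le_one_right (mul_nonneg (mul_nonneg (Nat.cast_nonneg _)
      ((pairInstance z m B α hz hB hBm hα).prob_pos j).le) (pairProfit_nonneg hα _)) hx

lemma gamma_pairInstance (hz : z ≠ 0) (hB : 0 < B) (hBm : B < m) (hα : 0 ≤ α)
    (hαB : (m - B) * α = B) (hα1 : α ≤ 1) :
    (pairInstance z m B α hz hB hBm hα).gamma = 1 / B := by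
  -- The maximum is attained by a `w_i` request on the all-false string; profit ratios are at most
  -- `1 / (2 * B)`.
  refine IsGreatest.csSup_eq ⟨Or.inl ⟨fun _ => false,
    finSumFinEquiv (Sum.inr ⟨0, Nat.pos_of_ne_zero hz⟩), (), ?_⟩, ?_⟩
  · simp only [pairInstance, Equiv.symm_apply_apply]
    simp [pairUse, vecW]
  · rintro y (⟨b, j, k, rfl⟩ | ⟨p, j, k, rfl⟩)
    · exact div_le_div_of_nonneg_right (pairUse_le_one hα1 b _) hB.le
    · rw [expectedOpt_pairInstance hz hB hBm hα hαB]
      exact div_le_div₀ zero_le_one (pairProfit_le_one hα1 _) hB (by linarith)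

/-! ### The expected loss -/

/-- The bound of `served_profit_le` in expectation. -/
lemma iidMean_bound_le (hz : z ≠ 0) (hB : 0 < B) (hBm : B < m) (hα : 0 ≤ α)
    (hαB : (m - B) * α = B) (hα1 : α ≤ 1) (hBz : (z : ℝ) ≤ B) :
    iidMean (fun j : Fin (z + z) => pairProb z m B (finSumFinEquiv.symm j)) m (fun r => B + ∑ i,
      (1 / 2 * (∑ t, (leftPart α i (finSumFinEquiv.symm (r t)) +
        rightPart i (finSumFinEquiv.symm (r t)))) + (-(1 / 2)) *
        |∑ t, (leftPart α i (finSumFinEquiv.symm (r t)) -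
          rightPart i (finSumFinEquiv.symm (r t)))|)) ≤ 2 * B - 3 / 16 * (z * √(B / z)) := by
  have hz' : (0 : ℝ) < z := Nat.cast_pos.2 (Nat.pos_of_ne_zero hz)
  have hm : (m : ℝ) ≠ 0 := (hB.trans hBm).ne'
  set p : Fin (z + z) → ℝ := fun j => pairProb z m B (finSumFinEquiv.symm j) with hp
  have p0 : ∀ j, 0 ≤ p j := fun j => ((pairInstance z m B α hz hB hBm hα).prob_pos j).le
  have p1 : ∑ j, p j = 1 := (pairInstance z m B α hz hB hBm hα).prob_sum
  have hmean : ∀ (i : Fin z) (g : ℝ → ℝ → ℝ) (_ : g 0 0 = 0) (β : ℝ) (_ : g α 0 = α * β),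
      (m : ℝ) * ∑ j, p j * g (leftPart α i (finSumFinEquiv.symm j))
        (rightPart i (finSumFinEquiv.symm j)) = B / z * (β + g 0 1) := by
    intro i g g0 β hβ
    rw [← mul_sum_pairProb_mul hz hm hαB i g g0 β hβ, ← finSumFinEquiv.symm.sum_comp fun j =>
      pairProb z m B j * g (leftPart α i j) (rightPart i j)]
  rw [iidMean_add, iidMean_const p1, iidMean_sum]
  have hi : ∀ i : Fin z, iidMean p m (fun r => 1 / 2 * (∑ t, (leftPart α i
      (finSumFinEquiv.symm (r t)) + rightPart i (finSumFinEquiv.symm (r t)))) + (-(1 / 2)) *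
        |∑ t, (leftPart α i (finSumFinEquiv.symm (r t)) -
          rightPart i (finSumFinEquiv.symm (r t)))|) ≤ B / z - 3 / 16 * √(B / z) := by
    intro i
    rw [iidMean_add, iidMean_const_mul, iidMean_const_mul,
      iidMean_linear p1 m fun j => leftPart α i (finSumFinEquiv.symm j) +
        rightPart i (finSumFinEquiv.symm j),
      hmean i (fun x y => x + y) (by simp) 1 (by simp)]
    have hvar := hmean i (fun x y => (x - y) ^ 2) (by simp) α (by ring)
    have hcent := hmean i (fun x y => x - y) (by simp) 1 (by ring)
    have hcent0 : ∑ j, p j * (leftPart α i (finSumFinEquiv.symm j) -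
        rightPart i (finSumFinEquiv.symm j)) = 0 := by
      have : (m : ℝ) * ∑ j, p j * (leftPart α i (finSumFinEquiv.symm j) -
        rightPart i (finSumFinEquiv.symm j)) = 0 := by rw [hcent]; ring
      exact (mul_eq_zero.1 this).resolve_left hm
    have hK : 1 ≤ B / z := (one_le_div hz').2 hBz
    -- The right side is the variance of the difference of the two totals of pair `i`; dropping `α`
    -- leaves a bound free of `m`.
    have hle : B / z ≤ B / z * (α + (0 - 1) ^ 2) := by nlinarith
    have habs := iidMean_abs_ge (m := m) (σ := √(B / z * (α + (0 - 1) ^ 2))) p0 p1 hcent0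
      (fun j => abs_leftPart_sub_rightPart_le hα hα1 i _)
      (Real.one_le_sqrt.2 (hK.trans hle))
      (by rw [hvar, Real.sq_sqrt (by linarith)])
    have hsqrt := Real.sqrt_le_sqrt hle
    linarith
  have := Finset.sum_le_sum fun i (_ : i ∈ Finset.univ) => hi i
  simp only [Finset.sum_const, Finset.card_univ, Fintype.card_fin, nsmul_eq_mul] at this
  have hcancel : (z : ℝ) * (B / z) = B := by field_simp
  refine (add_le_add_right this B).trans (le_of_eq ?_)
  linear_combination hcancel

lemma expectedProfit_pairInstance_le (hz : z ≠ 0) (hB : 0 < B) (hBm : B < m) (hα : 0 ≤ α)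
    (hαB : (m - B) * α = B) (hα1 : α ≤ 1) (hBz : (z : ℝ) ≤ B)
    {Ω : Type*} [MeasurableSpace Ω] {μ : MeasureTheory.Measure Ω}
    [MeasureTheory.IsProbabilityMeasure μ]
    (alg : OnlineAlgorithm (pairInstance z m B α hz hB hBm hα) Ω μ) :
    alg.expectedProfit ≤ 2 * B - 3 / 16 * (z * √(B / z)) := by
  refine le_trans ?_ (iidMean_bound_le hz hB hBm hα hαB hα1 hBz)
  refine iidMean_mono (fun j => ((pairInstance z m B α hz hB hBm hα).prob_pos j).le) (m := m)
    (F := fun r => ∫ ω, (pairInstance z m B α hz hB hBm hα).profit r (alg.choice ω r) ∂μ)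
    fun r => ?_
  have helim : ∀ (o : Option Unit) (f : Unit → ℝ),
      o.elim 0 f = (if o.isSome then 1 else 0) * f () := by
    rintro (_ | _) f <;> simp
  have hprofit : ∀ ω, (pairInstance z m B α hz hB hBm hα).profit r (alg.choice ω r) =
      ∑ t : Fin m, (if (alg.choice ω r t).isSome then 1 else 0) *
        pairProfit α (finSumFinEquiv.symm (r t)) := by
    intro ω
    simp only [Instance.profit, helim]
    rw [ciInf_unique]
    rfl
  -- The bound does not depend on the seed, so it only has to hold almost surely for fixed `r`.
  refine le_of_le_of_eq (MeasureTheory.integral_mono_of_nonneg (μ := μ) (g := fun _ => _)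
    (Filter.Eventually.of_forall fun ω => ?_) (MeasureTheory.integrable_const _) ?_)
    (MeasureTheory.integral_const _ |>.trans
      ((congrArg (· • _) MeasureTheory.probReal_univ).trans (one_smul ℝ _)))
  · simp only [Pi.zero_apply, hprofit]
    exact Finset.sum_nonneg fun t _ =>
      mul_nonneg (by split_ifs <;> simp) (pairProfit_nonneg hα _)
  · filter_upwards [alg.feasible r] with ω hω
    rw [hprofit]
    refine served_profit_le hα (fun t => finSumFinEquiv.symm (r t)) _
      (fun t => by split_ifs <;> simp) fun b => ?_
    have := hω b
    simp only [Instance.consumption, helim] at this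
    exact this

end HardInstance

end ResourceAllocation

/-! ### Choice of parameters -/

theorem mainTheorem2 :
    ∃ c > (0 : ℝ), ∃ ε₀ > (0 : ℝ), ∀ ε : ℝ, 0 < ε → ε ≤ ε₀ → ∀ z n : ℕ, 1 ≤ z → n = 2 ^ z →
      ∃ (N : ℕ) (α B : ℝ)
        (I : ResourceAllocation.Instance (Fin z → Bool) Unit (Fin N) Unit),
        0 < α ∧ α < 1 ∧ ResourceAllocation.IsComplementary α B I ∧
        0 < I.expectedOpt ∧
        I.gamma = ε ^ 2 / Real.log n ∧
        ∀ (Ω : Type*) [MeasurableSpace Ω] (μ : MeasureTheory.Measure Ω)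
          [MeasureTheory.IsProbabilityMeasure μ]
          (alg : ResourceAllocation.OnlineAlgorithm I Ω μ),
          alg.approxFactor ≤ 1 - c * ε := by
  refine ⟨1 / 16, by norm_num, 1 / 2, by norm_num, ?_⟩
  rintro ε hε hε₀ z n hz rfl
  have hz' : (0 : ℝ) < z := Nat.cast_pos.2 hz
  have hz0 : z ≠ 0 := by omega
  have hlog : Real.log ((2 ^ z : ℕ) : ℝ) = z * Real.log 2 := by
    push_cast
    exact Real.log_pow 2 z
  have hl2 := Real.log_two_gt_d9
  have hl2' := Real.log_two_lt_d9
  set B : ℝ := z * Real.log 2 / ε ^ 2 with hBdef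
  have hB : 0 < B := by positivity
  have hK : B / z = Real.log 2 / ε ^ 2 := by rw [hBdef]; field_simp
  -- This is where `ε ≤ 1 / 2` enters: `ε ^ 2 ≤ 1 / 4 < log 2`.
  have hBz : (z : ℝ) ≤ B := by
    rw [hBdef, le_div_iff₀ (by positivity)]
    exact mul_le_mul_of_nonneg_left (by nlinarith) hz'.le
  -- `m > 2 * B` is what makes `α = B / (m - B)` less than `1`.
  obtain ⟨m, hm⟩ := exists_nat_gt (2 * B)
  have hBm : B < m := by linarith
  have hmB : 0 < (m : ℝ) - B := by linarith
  have hαB : ((m : ℝ) - B) * (B / (m - B)) = B := mul_div_cancel₀ _ hmB.ne'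
  have hα : 0 < B / (m - B) := div_pos hB hmB
  have hα1 : B / (m - B) < 1 := (div_lt_one hmB).2 (by linarith)
  have hopt := ResourceAllocation.expectedOpt_pairInstance hz0 hB hBm hα.le hαB
  refine ⟨z + z, B / (m - B), B,
    ResourceAllocation.pairInstance z m B (B / (m - B)) hz0 hB hBm hα.le, hα, hα1,
    ResourceAllocation.isComplementary_pairInstance hz0 hB hBm hα.le, ?_, ?_, ?_⟩
  · rw [hopt]
    linarith
  · rw [ResourceAllocation.gamma_pairInstance hz0 hB hBm hα.le hαB hα1.le, hlog, hBdef, one_div_div]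
  · intro Ω _ μ _ alg
    rw [ResourceAllocation.OnlineAlgorithm.approxFactor, hopt, div_le_iff₀ (by linarith)]
    refine (ResourceAllocation.expectedProfit_pairInstance_le hz0 hB hBm hα.le hαB hα1.le
      hBz alg).trans ?_
    -- Using `log 2 ≤ √(log 2)`, the loss is at least `3 / 16 * ε * B`, above the required `1 / 16 *
    -- ε * (2 * B)`.
    have hsqrt : Real.log 2 / ε ≤ √(B / z) := by
      rw [hK]
      refine Real.le_sqrt_of_sq_le ?_
      rw [div_pow]
      exact div_le_div_of_nonneg_right (by nlinarith) (by positivity)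
    have hεB : ε * B = z * (Real.log 2 / ε) := by
      rw [hBdef]
      field_simp
    have := mul_le_mul_of_nonneg_left hsqrt hz'.le
    nlinarith
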